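/- For positive integers $n,q$ let $f=f_{n,q}:[q]^n\to\{0,1\}$ be the element distinctness function: $f(x)=0$ if $x_1,\dots,x_n$ are pairwise distinct and $f(x)=1$ otherwise. An adversary matrix for $f$ is a non-zero real matrix $\Gamma$ with rows indexed by $f^{-1}(1)$ and columns indexed by $f^{-1}(0)$. For $i\in[n]$ let $\Delta_i$ be the matrix of the same shape with $(\Delta_i)_{x,y}=1$ if $x_i\ne y_i$ and $0$ otherwise; let $\|\cdot\|$ be the spectral norm and $\circ$ the entrywise product. The negative-weight adversary bound is $$\mathrm{Adv}(f)=\sup_{\Gamma}\frac{\|\Gamma\|}{\max_{i\in[n]}\|\Gamma\circ\Delta_i\|},$$ the supremum being over all adversary matrices for $f$. Let $E_0$ be the $q\times q$ matrix with all entries $1/q$, and $E_1=I-E_0$. For a finite index set $S$ let $E_k^{S}=\sum_{v\in\{0,1\}^S,\,|v|=k}\bigotimes_{i\in S}E_{v_i}$, the projector onto the weight-$k$ eigenspace of the Hamming association scheme on $[q]^S$; write $E_k^{(m)}$ when $S=[m]$. For $\ell\in\{0,1\}$ let $F_\ell$ be the $q\times q^2$ matrix consisting of the rows $(s,s)$,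 $s\in[q]$, of $\sqrt q\,E^{(2)}_\ell$. Given reals $\alpha_0,\alpha_1,\dots\ge 0$ and $1\le a<b\le n$, let $G_{a,b}$ be the matrix with rows indexed by the $x\in[q]^n$ with $x_a=x_b$, columns indexed by $y\in[q]^n$, and $$G_{a,b}=\sum_{k=0}^{n-2}\alpha_k\,(F_0+F_1)\otimes E_k^{[n]\setminus\{a,b\}},$$ where $F_0+F_1$ acts on positions $a,b$. Let $\Gamma'_\alpha$ be the matrix obtained by stacking all blocks $G_{a,b}$, and let $\Gamma_\alpha$ be obtained from it by striking out every column $y$ with two equal symbols and every row $x$ of a block $G_{a,b}$ with $x_i=x_j$ for some $i\neq j$, $\{i,j\}\ne\{a,b\}$; adding zero rows for inputs with more than one colliding pair, regard $\Gamma_\alpha$ as a matrix with rows indexed by $f^{-1}(1)$ and columns indexed by $f^{-1}(0)$. Theorem. For every $c>0$ there is a constant $C>0$, depending only on $c$, such that for all $n\ge 2$ and all $q\ge n$ with $q\ge c\,n^2$ there exists an adversary matrix $\Gamma$ for $f_{n,q}$, of the form $\Gamma=\Gamma_\alpha$ for some non-negative reals $\alpha_k$, such that $\max_{i}\|\Gamma\circ\Delta_i\|>0$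 and $$\frac{\|\Gamma\|}{\max_{i\in[n]}\|\Gamma\circ\Delta_i\|}\ \ge\ C\,n^{2/3}.$$ In particular, $\mathrm{Adv}(f_{n,q})\ge C\,n^{2/3}$. -/

import Mathlib

open scoped Matrix ENNReal

noncomputable section

namespace AdvED

/-! ### The negative-weight adversary bound

Inputs are strings in `[q]^n`, modelled as `Fin n → Fin q`; the values `0`, `1` of a Boolean
function are `false`, `true`. -/

/-- `f⁻¹(1)`: the row labels of adversary matrices for `f`. -/
abbrev Pos {n q : ℕ} (f : (Fin n → Fin q) → Bool) : Type := {x : Fin n → Fin q // f x = true}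

/-- `f⁻¹(0)`: the column labels of adversary matrices for `f`. -/
abbrev Neg {n q : ℕ} (f : (Fin n → Fin q) → Bool) : Type := {y : Fin n → Fin q // f y = false}

/-- Real matrices with rows indexed by `f⁻¹(1)` and columns indexed by `f⁻¹(0)`.
The set of adversary matrices consists of the nonzero ones. -/
abbrev AdvMatrix {n q : ℕ} (f : (Fin n → Fin q) → Bool) : Type := Matrix (Pos f) (Neg f) ℝ

/-- The 0/1 matrix `Δ_i`, with entry `(x, y)` equal to `1` iff `x_i ≠ y_i`. -/
def Delta {n q : ℕ} (f : (Fin n → Fin q) → Bool) (i : Fin n) : AdvMatrix f :=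
  Matrix.of fun x y => if x.1 i ≠ y.1 i then 1 else 0

section

open scoped Matrix.Norms.L2Operator

/-- The spectral norm (largest singular value) of a real matrix: its operator norm with respect to
the Euclidean norms. -/
def specNorm {m k : Type*} [Fintype m] [Fintype k] [DecidableEq k] (A : Matrix m k ℝ) : ℝ := ‖A‖

end

/-- `max_i ‖Γ ∘ Δ_i‖`, with `∘` the entrywise product. -/
def maxDeltaNorm {n q : ℕ} (f : (Fin n → Fin q) → Bool) (Γ : AdvMatrix f) : ℝ :=
  ⨆ i : Fin n, specNorm (Γ ⊙ Delta f i)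

/-- The adversary quotient `‖Γ‖ / max_i ‖Γ ∘ Δ_i‖`. The denominator is positive for every
nonzero `Γ`, since a row label and a column label always differ in some position. -/
def advRatio {n q : ℕ} (f : (Fin n → Fin q) → Bool) (Γ : AdvMatrix f) : ℝ :=
  specNorm Γ / maxDeltaNorm f Γ

/-- The negative-weight adversary bound of `f`: the supremum of the adversary quotient over all
nonzero adversary matrices (taken in `[0, ∞]`, so that no boundedness has to be known). -/
def adv {n q : ℕ} (f : (Fin n → Fin q) → Bool) : ℝ≥0∞ :=
  ⨆ (Γ : AdvMatrix f) (_ : Γ ≠ 0), ENNReal.ofReal (advRatio f Γ)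

/-- Element distinctness on `[q]^n`: `0` if all symbols are pairwise distinct, `1` otherwise. -/
def elementDistinctness (n q : ℕ) (x : Fin n → Fin q) : Bool :=
  decide (∃ i j : Fin n, i ≠ j ∧ x i = x j)

/-! ### The explicit matrices built from the Hamming association scheme -/

/-- `E₀`: the projector onto the constant vectors of `ℝ^q`; all entries are `1/q`. -/
def E0 (q : ℕ) : Matrix (Fin q) (Fin q) ℝ := Matrix.of fun _ _ => 1 / (q : ℝ)

/-- `E₁ = I - E₀`: the projector onto the orthogonal complement of the constant vectors. -/
def E1 (q : ℕ) : Matrix (Fin q) (Fin q) ℝ := 1 - E0 q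

/-- The projector `E_k` onto the weight-`k` eigenspace of the Hamming association scheme on
`[q]^ι`: the sum, over all `v ∈ {0,1}^ι` of weight `k` (given by their supports), of the tensor
products `⊗_i E_{v_i}`. -/
def hammingProj (q : ℕ) (ι : Type) [Fintype ι] [DecidableEq ι] (k : ℕ) :
    Matrix (ι → Fin q) (ι → Fin q) ℝ :=
  Matrix.of fun x y => ∑ v ∈ (Finset.univ : Finset ι).powersetCard k,
    ∏ i, if i ∈ v then E1 q (x i) (y i) else E0 q (x i) (y i)

/-- The `q × q²` matrix `F_ℓ`: the multiple `√q · E_ℓ^{(2)}`, of which only the rows `(s, s)` with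
two equal symbols are kept. -/
def F (q l : ℕ) : Matrix (Fin q) (Fin q × Fin q) ℝ :=
  Matrix.of fun s t => √(q : ℝ) * hammingProj q (Fin 2) l ![s, s] ![t.1, t.2]

/-- The block `G_{a,b} = ∑_k α_k (F₀ + F₁) ⊗ E_k^{(n-2)}`, where `F₀ + F₁` acts on the positions
`a, b` and `E_k^{(n-2)}` on the other positions. It is used for rows `x` with `x_a = x_b`. -/
def G (n q : ℕ) (α : ℕ → ℝ) (a b : Fin n) (x y : Fin n → Fin q) : ℝ :=
  ∑ k ∈ Finset.range (n - 1),
    α k * ((F q 0 + F q 1) (x a) (y a, y b) *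
      hammingProj q {i : Fin n // i ≠ a ∧ i ≠ b} k (fun i => x i) (fun i => y i))

/-- Row labels of the enlarged matrix: a pair `a < b` of positions together with a string `x`
such that `x_a = x_b`. -/
abbrev ExtRow (n q : ℕ) : Type :=
  {r : (Fin n × Fin n) × (Fin n → Fin q) // r.1.1 < r.1.2 ∧ r.2 r.1.1 = r.2 r.1.2}

/-- The enlarged matrix `Γ'`: the blocks `G_{a,b}`, `a < b`, stacked on one another. -/
def enlargedMatrix (n q : ℕ) (α : ℕ → ℝ) : Matrix (ExtRow n q) (Fin n → Fin q) ℝ :=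
  Matrix.of fun r y => G n q α r.1.1.1 r.1.1.2 r.1.2 y

/-- A row `x` of the block `G_{a,b}` is legal if `x_i = x_j` for no pair `i < j` other than
`a < b`. -/
def ExtRow.Legal {n q : ℕ} (r : ExtRow n q) : Prop :=
  ∀ i j : Fin n, i < j → r.1.2 i = r.1.2 j → (i, j) = r.1.1

open Classical in
/-- The matrix `Γ` obtained from `Γ'` by striking out all illegal rows and columns. A positive
input labels at most one legal row; positive inputs labelling none (those with more than one
colliding pair) receive a zero row. The legal columns are exactly the negative inputs. -/
def struckMatrix (n q : ℕ) (α : ℕ → ℝ) : AdvMatrix (elementDistinctness n q) :=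
  Matrix.of fun x y => ∑ r : ExtRow n q,
    if r.Legal ∧ r.1.2 = x.1 then enlargedMatrix n q α r y.1 else 0

end AdvED

end

/-! On rows with `x a = x b`, the block `G_{a,b}` is `√q` times an operator diagonal in the
orthogonal projectors `tensorProj S`, with coefficient `α_{|S \ {a,b}|}`, or `0` if `S` contains
both `a` and `b` (`G_eq_scheme`). An operator supported on sets avoiding `a` has images independent
of `x a`, so restricting to `x a = x b` divides squared norms by `q`, which the factor `√q` offsets.
Norms thus become weighted sums of the energies `energy S v`, whose total is `‖v‖²`.

Upper bound. Where `x i ≠ y i`, `E₁` and `-E₀` have equal entries, so `S ∪ {i}` folds onto `S`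
(`scheme_foldCoeff`); returning to `Γ ∘ Δ_i` at most doubles the norm bound (`sum_hadamard_sq_le`).
Blocks with `i ∉ {a,b}` retain differences `α_k - α_{k+1}`; there are fewer than `n²` of them, so
differences of size `1/n` are affordable. Blocks pairing `i` with `b` keep only sets `S ∋ b`, with
coefficient `α_{|S|-1}`; summed over `b`, each `S` counts `|S|` times, which requires `(k+1) α_k² =
O(1)`. The weights `max (n^{-1/3} - k/n) 0` meet both demands: slope at most `1/n`, support `k <
n^{2/3}`.

Lower bound. `Γ` is applied to the all-ones vector and paired with coordinate averages of the
indicator of injective strings. These averages vanish on illegal rows, so striking those rows is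
harmless. Each block contributes nonnegative multiples of energies, and `S = ∅` alone suffices
(`le_sum_diagonal_block`). Cauchy–Schwarz gives `‖Γ‖ ≥ √(n(n-1)/2) α_0 N/q^n`, with `N` the number
of injective strings; `N/q^n` is bounded below when `q ≥ c n²`. -/

noncomputable section

namespace AdvED

open Finset

/-! ### Orthogonal projectors of the Hamming scheme and their energies -/

variable {n q : ℕ}

/-- The tensor product `⊗_j E_{[j ∈ S]}`. -/
def tensorProj (S : Finset (Fin n)) (x y : Fin n → Fin q) : ℝ :=
  ∏ j, if j ∈ S then E1 q (x j) (y j) else E0 q (x j) (y j)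

/-- The quadratic form of `tensorProj S`. -/
def energy (S : Finset (Fin n)) (v : (Fin n → Fin q) → ℝ) : ℝ :=
  ∑ x, v x * ∑ y, tensorProj S x y * v y

/-- The operator `∑_S t_S ⊗_j E_{[j ∈ S]}`, as a kernel. -/
def scheme (t : Finset (Fin n) → ℝ) (x y : Fin n → Fin q) : ℝ :=
  ∑ S, t S * tensorProj S x y

lemma E0_symm (s t : Fin q) : E0 q s t = E0 q t s := rfl

lemma E1_apply (s t : Fin q) : E1 q s t = (if s = t then 1 else 0) - 1 / (q : ℝ) := by
  simp [E1, E0, Matrix.one_apply]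

lemma E1_symm (s t : Fin q) : E1 q s t = E1 q t s := by
  simp only [E1_apply, eq_comm]

lemma tensorProj_symm (S : Finset (Fin n)) (x y : Fin n → Fin q) :
    tensorProj S x y = tensorProj S y x := by
  unfold tensorProj
  refine prod_congr rfl fun j _ => ?_
  rw [E0_symm, E1_symm]

lemma sum_E_mul_E (p r : Prop) [Decidable p] [Decidable r] (s u : Fin q) :
    ∑ t, (if p then E1 q s t else E0 q s t) * (if r then E1 q t u else E0 q t u)
      = if p ↔ r then (if p then E1 q s u else E0 q s u) else 0 := by
  have hq : (q : ℝ) ≠ 0 := by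
    have := s.pos
    positivity
  have h00 : E0 q * E0 q = E0 q := by
    ext i j
    simp [E0, Matrix.mul_apply]
    field_simp
  have h01 : E0 q * E1 q = 0 := by rw [E1, mul_sub, h00, mul_one, sub_self]
  have h10 : E1 q * E0 q = 0 := by rw [E1, sub_mul, h00, one_mul, sub_self]
  have h11 : E1 q * E1 q = E1 q := by
    conv_lhs => rw [E1, mul_sub, ← E1, h10, mul_one, sub_zero]
  by_cases hp : p <;> by_cases hr : r <;> simp only [hp, hr, if_true, if_false, iff_true,
    iff_false, not_true, ← Matrix.mul_apply, h00, h01, h10, h11,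
    Matrix.zero_apply]

lemma sum_tensorProj_mul (S T : Finset (Fin n)) (x z : Fin n → Fin q) :
    ∑ y, tensorProj S x y * tensorProj T y z = if S = T then tensorProj S x z else 0 := by
  unfold tensorProj
  simp only [← prod_mul_distrib]
  have := Finset.prod_univ_sum (fun _ : Fin n => (univ : Finset (Fin q))) (fun j t =>
    (if j ∈ S then E1 q (x j) t else E0 q (x j) t) * (if j ∈ T then E1 q t (z j) else E0 q t (z j)))
  rw [Fintype.piFinset_univ] at this
  rw [← this]
  simp only [sum_E_mul_E]
  split_ifs with h
  · subst h
    simp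
  · have : ∃ j, ¬ (j ∈ S ↔ j ∈ T) := by
      by_contra! h'
      exact h (Finset.ext h')
    obtain ⟨j, hj⟩ := this
    exact prod_eq_zero (mem_univ j) (if_neg hj)

lemma sum_tensorProj (x y : Fin n → Fin q) :
    ∑ S, tensorProj S x y = if x = y then 1 else 0 := by
  have h := Finset.prod_add (fun j => E1 q (x j) (y j)) (fun j => E0 q (x j) (y j))
    (univ : Finset (Fin n))
  have h2 : ∀ S : Finset (Fin n), tensorProj S x y
      = (∏ j ∈ S, E1 q (x j) (y j)) * ∏ j ∈ univ \ S, E0 q (x j) (y j) := by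
    intro S
    unfold tensorProj
    rw [prod_ite]
    congr 1
    · congr 1; ext; simp
    · congr 1; ext; simp
  simp only [h2]
  rw [powerset_univ] at h
  rw [← h]
  have h3 : ∀ j, E1 q (x j) (y j) + E0 q (x j) (y j) = if x j = y j then 1 else 0 := by
    intro j
    rw [E1_apply]
    simp [E0]
  simp only [h3, prod_ite_zero, prod_const_one, funext_iff, mem_univ, true_imp_iff]

lemma sum_tensorProj_apply_mul (S T : Finset (Fin n)) (v : (Fin n → Fin q) → ℝ) :
    ∑ x, (∑ y, tensorProj S x y * v y) * (∑ z, tensorProj T x z * v z)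
      = if S = T then energy S v else 0 := by
  calc ∑ x, (∑ y, tensorProj S x y * v y) * (∑ z, tensorProj T x z * v z)
      = ∑ x, ∑ y, v y * ∑ z, tensorProj S y x * tensorProj T x z * v z := by
        refine sum_congr rfl fun x _ => ?_
        rw [sum_mul]
        refine sum_congr rfl fun y _ => ?_
        rw [mul_sum, mul_sum]
        refine sum_congr rfl fun z _ => ?_
        rw [tensorProj_symm S x y]
        ring
    _ = ∑ y, v y * ∑ z, (∑ x, tensorProj S y x * tensorProj T x z) * v z := by
        rw [sum_comm]
        refine sum_congr rfl fun y _ => ?_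
        rw [← mul_sum, sum_comm]
        simp only [sum_mul]
    _ = _ := by
        simp only [sum_tensorProj_mul]
        split_ifs
        · rfl
        · simp

lemma energy_eq_sum_sq (S : Finset (Fin n)) (v : (Fin n → Fin q) → ℝ) :
    energy S v = ∑ x, (∑ y, tensorProj S x y * v y) ^ 2 := by
  simp only [sq, sum_tensorProj_apply_mul, if_true]

lemma energy_nonneg (S : Finset (Fin n)) (v : (Fin n → Fin q) → ℝ) : 0 ≤ energy S v := by
  rw [energy_eq_sum_sq]
  positivity

lemma sum_energy (v : (Fin n → Fin q) → ℝ) : ∑ S, energy S v = ∑ x, v x ^ 2 := by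
  unfold energy
  rw [sum_comm]
  refine sum_congr rfl fun x _ => ?_
  rw [← mul_sum, sum_comm]
  simp only [← sum_mul, sum_tensorProj]
  simp [sq]

lemma energy_empty (v : (Fin n → Fin q) → ℝ) : energy ∅ v = (∑ x, v x) ^ 2 / (q : ℝ) ^ n := by
  simp only [energy, tensorProj, notMem_empty, if_false, E0, Matrix.of_apply, prod_const,
    card_univ, Fintype.card_fin, ← mul_sum, ← sum_mul]
  rw [one_div, inv_pow]
  ring

lemma scheme_apply (t : Finset (Fin n) → ℝ) (v : (Fin n → Fin q) → ℝ) (x : Fin n → Fin q) :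
    ∑ y, scheme t x y * v y = ∑ S, t S * ∑ y, tensorProj S x y * v y := by
  simp only [scheme, sum_mul, mul_sum]
  rw [sum_comm]
  simp only [mul_assoc]

lemma sum_scheme_sq (t : Finset (Fin n) → ℝ) (v : (Fin n → Fin q) → ℝ) :
    ∑ x, (∑ y, scheme t x y * v y) ^ 2 = ∑ S, t S ^ 2 * energy S v := by
  simp only [scheme_apply, sq, sum_mul_sum]
  rw [sum_comm]
  refine sum_congr rfl fun S _ => ?_
  rw [sum_comm]
  have : ∀ T : Finset (Fin n), ∑ x : Fin n → Fin q, t S * (∑ y, tensorProj S x y * v y) *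
      (t T * ∑ y, tensorProj T x y * v y) = t S * t T * if S = T then energy S v else 0 := by
    intro T
    rw [← sum_tensorProj_apply_mul, mul_sum]
    exact sum_congr rfl fun x _ => by ring
  simp [this]

/-! ### Functions not depending on a coordinate -/

lemma sum_sum_update (a : Fin n) (f : (Fin n → Fin q) → ℝ) :
    ∑ x, ∑ s, f (Function.update x a s) = q * ∑ x, f x := by
  -- Exchanging `s` with `x a` permutes the pairs `(x, s)`.
  have hinv : Function.Involutive
      (fun p : (Fin n → Fin q) × Fin q => (Function.update p.1 a p.2, p.1 a)) := by
    rintro ⟨x, s⟩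
    simp
  have h := Equiv.sum_comp hinv.toPerm (fun p => f p.1)
  rw [Fintype.sum_prod_type, Fintype.sum_prod_type] at h
  simpa [← mul_sum] using h

/-- As `h` ignores `x a`, the condition `x a = x b` selects one of `q` equal contributions. -/
lemma sum_diagonal {a b : Fin n} (hab : a ≠ b) (h : (Fin n → Fin q) → ℝ)
    (hh : ∀ x s, h (Function.update x a s) = h x) :
    q * ∑ x, (if x a = x b then h x else 0) = ∑ x, h x := by
  rw [← sum_sum_update a]
  simp [hh, Function.update_of_ne hab.symm]

lemma tensorProj_update {a : Fin n} {S : Finset (Fin n)} (ha : a ∉ S) (x y : Fin n → Fin q)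
    (s : Fin q) : tensorProj S (Function.update x a s) y = tensorProj S x y := by
  unfold tensorProj
  refine prod_congr rfl fun j _ => ?_
  by_cases hj : j = a
  · subst hj
    simp [ha, E0]
  · simp [Function.update_of_ne hj]

lemma scheme_update {a : Fin n} {t : Finset (Fin n) → ℝ} (ht : ∀ S, a ∈ S → t S = 0)
    (x y : Fin n → Fin q) (s : Fin q) : scheme t (Function.update x a s) y = scheme t x y := by
  refine sum_congr rfl fun S _ => ?_
  by_cases ha : a ∈ S
  · simp [ht S ha]
  · rw [tensorProj_update ha]

lemma sum_diagonal_scheme_sq {a b : Fin n} (hab : a ≠ b) {t : Finset (Fin n) → ℝ}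
    (ht : ∀ S, a ∈ S → t S = 0) (v : (Fin n → Fin q) → ℝ) :
    q * ∑ x : Fin n → Fin q, (if x a = x b then (∑ y, scheme t x y * v y) ^ 2 else 0)
      = ∑ S, t S ^ 2 * energy S v := by
  rw [sum_diagonal hab (fun x => (∑ y, scheme t x y * v y) ^ 2), sum_scheme_sq]
  intro x s
  simp only [scheme_update ht]

lemma scheme_add (t u : Finset (Fin n) → ℝ) (x y : Fin n → Fin q) :
    scheme (fun S => t S + u S) x y = scheme t x y + scheme u x y := by
  simp [scheme, add_mul, sum_add_distrib]

/-- Splitting `t` by whether `a ∈ S` gives one part avoiding `a` and one avoiding `b`, each with an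
exact identity. The factor 2 pays for the cross term. -/
lemma sum_diagonal_scheme_sq_le {a b : Fin n} (hab : a ≠ b) {t : Finset (Fin n) → ℝ}
    (ht : ∀ S, a ∈ S → b ∈ S → t S = 0) (v : (Fin n → Fin q) → ℝ) :
    q * ∑ x : Fin n → Fin q, (if x a = x b then (∑ y, scheme t x y * v y) ^ 2 else 0)
      ≤ 2 * ∑ S, t S ^ 2 * energy S v := by
  set t₁ : Finset (Fin n) → ℝ := fun S => if a ∈ S then 0 else t S with ht₁
  set t₂ : Finset (Fin n) → ℝ := fun S => if a ∈ S then t S else 0 with ht₂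
  have h₁ := sum_diagonal_scheme_sq hab (t := t₁) (fun S h => by simp [ht₁, h]) v
  have h₂ := sum_diagonal_scheme_sq hab.symm (t := t₂)
    (fun S h => by simp only [ht₂]; split_ifs with h'; exacts [ht S h' h, rfl]) v
  have hsum : t = fun S => t₁ S + t₂ S := by
    ext S
    simp only [ht₁, ht₂]
    split_ifs <;> simp
  have henergy : ∑ S, t S ^ 2 * energy S v
      = ∑ S, t₁ S ^ 2 * energy S v + ∑ S, t₂ S ^ 2 * energy S v := by
    rw [← sum_add_distrib]
    refine sum_congr rfl fun S _ => ?_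
    simp only [ht₁, ht₂]
    split_ifs <;> simp
  rw [henergy, ← h₁, ← h₂, ← mul_add, mul_left_comm, ← sum_add_distrib, mul_sum _ _ (2 : ℝ)]
  have hq : (0 : ℝ) ≤ q := Nat.cast_nonneg q
  refine mul_le_mul_of_nonneg_left (sum_le_sum fun x _ => ?_) hq
  by_cases hx : x a = x b
  · rw [if_pos hx, if_pos hx, if_pos hx.symm, hsum]
    simp only [scheme_add, add_mul, sum_add_distrib]
    exact add_sq_le
  · rw [if_neg hx, if_neg hx, if_neg (Ne.symm hx)]
    simp

/-! ### Removing the entries that agree in a coordinate -/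

lemma tensorProj_insert_of_ne {i : Fin n} {S : Finset (Fin n)} (hi : i ∉ S)
    {x y : Fin n → Fin q} (hxy : x i ≠ y i) :
    tensorProj (insert i S) x y = - tensorProj S x y := by
  unfold tensorProj
  rw [← mul_prod_erase univ _ (mem_univ i), ← mul_prod_erase univ _ (mem_univ i), ← neg_mul]
  congr 1
  · simp [hi, E1_apply, hxy, E0]
  · refine prod_congr rfl fun j hj => ?_
    simp [ne_of_mem_erase hj]

/-- Coefficients of a scheme operator supported away from `i`, with the same entries at all
`(x, y)` with `x_i ≠ y_i`. -/
def foldCoeff (i : Fin n) (t : Finset (Fin n) → ℝ) (S : Finset (Fin n)) : ℝ :=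
  if i ∈ S then 0 else t S - t (insert i S)

lemma scheme_foldCoeff {i : Fin n} (t : Finset (Fin n) → ℝ) {x y : Fin n → Fin q}
    (hxy : x i ≠ y i) : scheme (foldCoeff i t) x y = scheme t x y := by
  have hu : (univ : Finset (Fin n)) = insert i (univ.erase i) := (insert_erase (mem_univ i)).symm
  unfold scheme
  rw [← powerset_univ, hu, sum_powerset_insert (notMem_erase i univ),
    sum_powerset_insert (notMem_erase i univ), ← sum_add_distrib, ← sum_add_distrib]
  refine sum_congr rfl fun S hS => ?_
  have hi : i ∉ S := fun h => notMem_erase i univ (mem_powerset.1 hS h)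
  rw [tensorProj_insert_of_ne hi hxy]
  simp only [foldCoeff, hi, if_false, mem_insert_self, if_true]
  ring

lemma sum_hadamard_sq_le {R : Type*} [Fintype R] (ξ : R → Fin n → Fin q) (i : Fin n)
    (A : R → (Fin n → Fin q) → ℝ) {B : ℝ}
    (hA : ∀ v : (Fin n → Fin q) → ℝ, ∑ r, (∑ y, A r y * v y) ^ 2 ≤ B * ∑ y, v y ^ 2)
    (v : (Fin n → Fin q) → ℝ) :
    ∑ r, (∑ y, (if ξ r i ≠ y i then A r y else 0) * v y) ^ 2 ≤ 4 * B * ∑ y, v y ^ 2 := by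
  -- Row `r` meets only the slice `y i = ξ r i` of `v`. The slices have disjoint supports, so the
  -- bounds from `hA` for each slice add up to `B * ‖v‖²`.
  have hdiag : ∑ r, (∑ y, (if ξ r i = y i then A r y else 0) * v y) ^ 2
      ≤ B * ∑ y, v y ^ 2 := by
    calc ∑ r, (∑ y, (if ξ r i = y i then A r y else 0) * v y) ^ 2
        ≤ ∑ r, ∑ s, (∑ y, A r y * (if s = y i then v y else 0)) ^ 2 := by
          refine sum_le_sum fun r _ => ?_
          refine le_trans (le_of_eq ?_) (single_le_sum
            (f := fun s => (∑ y, A r y * (if s = y i then v y else 0)) ^ 2)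
            (fun s _ => sq_nonneg _) (mem_univ (ξ r i)))
          simp only [ite_mul, zero_mul, mul_ite, mul_zero]
      _ = ∑ s, ∑ r, (∑ y, A r y * (if s = y i then v y else 0)) ^ 2 := sum_comm
      _ ≤ ∑ s, B * ∑ y : Fin n → Fin q, (if s = y i then v y else 0) ^ 2 :=
          sum_le_sum fun s _ => hA _
      _ = B * ∑ y, v y ^ 2 := by
          rw [← mul_sum, sum_comm]
          simp
  calc ∑ r, (∑ y, (if ξ r i ≠ y i then A r y else 0) * v y) ^ 2
      ≤ ∑ r, (2 * ((∑ y, A r y * v y) ^ 2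
          + (∑ y, (if ξ r i = y i then A r y else 0) * v y) ^ 2)) := by
        refine sum_le_sum fun r _ => ?_
        have : ∑ y, (if ξ r i ≠ y i then A r y else 0) * v y
            = ∑ y, A r y * v y + -∑ y, (if ξ r i = y i then A r y else 0) * v y := by
          rw [← sum_neg_distrib, ← sum_add_distrib]
          refine sum_congr rfl fun y _ => ?_
          by_cases h : ξ r i = y i <;> simp [h]
        rw [this]
        refine add_sq_le.trans (le_of_eq ?_)
        rw [neg_sq]
    _ ≤ 4 * B * ∑ y, v y ^ 2 := by
        rw [← mul_sum, sum_add_distrib]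
        linarith [hA v]

/-! ### The blocks as scheme operators -/

/-- The coefficients of the block `G_{a,b}`, up to the factor `√q`. -/
def blockCoeff (α : ℕ → ℝ) (a b : Fin n) (S : Finset (Fin n)) : ℝ :=
  if a ∈ S ∧ b ∈ S then 0 else α #((S.erase a).erase b)

lemma F_zero_add_F_one (s t u : Fin q) :
    (F q 0 + F q 1) s (t, u) = √(q : ℝ) *
      (E0 q s t * E0 q s u + E1 q s t * E0 q s u + E0 q s t * E1 q s u) := by
  simp [F, hammingProj, powersetCard_one, Fin.prod_univ_two, Fin.sum_univ_two]
  ring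

lemma sum_hammingProj {ι : Type} [Fintype ι] [DecidableEq ι] (α : ℕ → ℝ) (x y : ι → Fin q) :
    ∑ k ∈ range (Fintype.card ι + 1), α k * hammingProj q ι k x y
      = ∑ U : Finset ι, α #U * ∏ i, if i ∈ U then E1 q (x i) (y i) else E0 q (x i) (y i) := by
  rw [← powerset_univ, sum_powerset, card_univ]
  refine sum_congr rfl fun k _ => ?_
  simp only [hammingProj, Matrix.of_apply, mul_sum]
  refine sum_congr rfl fun U hU => ?_
  rw [(mem_powersetCard.1 hU).2]

/-- `F₀ + F₁` omits `E₁ ⊗ E₁` on positions `a, b`, whence the vanishing coefficient; `x a = x b`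
allows the repeated symbol to be read at both positions. -/
lemma G_eq_scheme (α : ℕ → ℝ) {a b : Fin n} (hab : a ≠ b) {x : Fin n → Fin q} (hx : x a = x b)
    (y : Fin n → Fin q) : G n q α a b x y = √(q : ℝ) * scheme (blockCoeff α a b) x y := by
  set R : Finset (Fin n) := univ.filter fun i => i ≠ a ∧ i ≠ b with hR
  have haR : a ∉ R := by simp [hR]
  have hbR : b ∉ R := by simp [hR]
  have habR : a ∉ insert b R := by simp [hR, hab]
  have hu : (univ : Finset (Fin n)) = insert a (insert b R) := by
    ext i
    simp only [hR, mem_univ, mem_insert, mem_filter, true_and, true_iff]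
    tauto
  -- The range in `G` therefore covers every weight on the remaining positions.
  have hcard : Fintype.card {i : Fin n // i ≠ a ∧ i ≠ b} + 1 = n - 1 := by
    have h1 : #R = Fintype.card {i : Fin n // i ≠ a ∧ i ≠ b} := by
      rw [Fintype.card_subtype]
    have h2 := congrArg card hu
    rw [card_univ, Fintype.card_fin, card_insert_of_notMem habR, card_insert_of_notMem hbR] at h2
    omega
  have hprod : ∀ S : Finset (Fin n), tensorProj S x y
      = (if a ∈ S then E1 q (x a) (y a) else E0 q (x a) (y a)) *
        ((if b ∈ S then E1 q (x b) (y b) else E0 q (x b) (y b)) *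
          ∏ j ∈ R, if j ∈ S then E1 q (x j) (y j) else E0 q (x j) (y j)) := by
    intro S
    unfold tensorProj
    rw [hu, prod_insert habR, prod_insert hbR]
  have hsub : ∑ U : Finset {i : Fin n // i ≠ a ∧ i ≠ b}, α #U * ∏ i : {i : Fin n // i ≠ a ∧ i ≠ b},
        (if i ∈ U then E1 q (x i) (y i) else E0 q (x i) (y i))
      = ∑ U ∈ R.powerset, α #U *
          ∏ j ∈ R, if j ∈ U then E1 q (x j) (y j) else E0 q (x j) (y j) := by
    refine sum_bij (fun U _ => U.map (Function.Embedding.subtype _)) ?_ ?_ ?_ ?_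
    · intro U _
      rw [mem_powerset]
      intro j hj
      obtain ⟨i, -, rfl⟩ := mem_map.1 hj
      simpa [hR] using i.2
    · intro U _ V _ h
      exact map_injective _ h
    · intro V hV
      refine ⟨V.subtype _, mem_univ _, ?_⟩
      rw [subtype_map_of_mem]
      intro j hj
      simpa [hR] using mem_powerset.1 hV hj
    · intro U _
      rw [card_map, prod_subtype R (p := fun i => i ≠ a ∧ i ≠ b) (by simp [hR])]
      congr 1
      refine prod_congr rfl fun i _ => ?_
      have : (i : Fin n) ∈ U.map (Function.Embedding.subtype _) ↔ i ∈ U := by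
        simp [i.2]
      simp only [this]
  have hG : G n q α a b x y = (F q 0 + F q 1) (x a) (y a, y b) *
      ∑ U ∈ R.powerset, α #U *
          ∏ j ∈ R, if j ∈ U then E1 q (x j) (y j) else E0 q (x j) (y j) := by
    rw [← hsub, ← sum_hammingProj α (fun i : {i : Fin n // i ≠ a ∧ i ≠ b} => x i) (fun i => y i),
      hcard, mul_sum, G]
    exact sum_congr rfl fun k _ => by ring
  rw [hG, F_zero_add_F_one, mul_assoc]
  congr 1
  unfold scheme
  rw [← powerset_univ, hu, sum_powerset_insert habR, sum_powerset_insert hbR,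
    sum_powerset_insert hbR, ← sum_add_distrib, ← sum_add_distrib, ← sum_add_distrib, mul_sum]
  refine sum_congr rfl fun U hU => ?_
  have hUR := mem_powerset.1 hU
  have haU : a ∉ U := fun h => haR (hUR h)
  have hbU : b ∉ U := fun h => hbR (hUR h)
  have hins : ∀ c ∉ R, ∀ V : Finset (Fin n),
      ∏ j ∈ R, (if j ∈ insert c V then E1 q (x j) (y j) else E0 q (x j) (y j))
        = ∏ j ∈ R, (if j ∈ V then E1 q (x j) (y j) else E0 q (x j) (y j)) := by
    intro c hc V
    refine prod_congr rfl fun j hj => ?_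
    have : j ≠ c := fun h => hc (h ▸ hj)
    simp [this]
  simp only [hprod, hins a haR, hins b hbR]
  simp [blockCoeff, haU, hbU, hab, hab.symm, hx]
  ring

/-! ### Removing illegal rows and columns -/

lemma elementDistinctness_eq_false {x : Fin n → Fin q} :
    elementDistinctness n q x = false ↔ Function.Injective x := by
  simp only [elementDistinctness, decide_eq_false_iff_not]
  push Not
  exact ⟨fun h i j hij => by_contra fun hne => h i j hne hij, fun h i j hne hij => hne (h hij)⟩

lemma ExtRow.legal_unique {r s : ExtRow n q} (hr : r.Legal) (h : r.1.2 = s.1.2) : r = s := by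
  refine Subtype.ext (Prod.ext ?_ h)
  have := hr s.1.1.1 s.1.1.2 s.2.1 (h ▸ s.2.2)
  exact this.symm

lemma ExtRow.elementDistinctness_eq_true (r : ExtRow n q) :
    elementDistinctness n q r.1.2 = true := by
  simp only [elementDistinctness, decide_eq_true_eq]
  exact ⟨_, _, r.2.1.ne, r.2.2⟩

-- A string labels at most one legal row, so each inner sum has at most one nonzero term and
-- squaring passes through it.
open Classical in
lemma sum_sq_legal (g : ExtRow n q → ℝ) :
    ∑ x : Pos (elementDistinctness n q),
      (∑ r : ExtRow n q, if r.Legal ∧ r.1.2 = x.1 then g r else 0) ^ 2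
      = ∑ r : ExtRow n q, if r.Legal then g r ^ 2 else 0 := by
  have h1 : ∀ x : Pos (elementDistinctness n q),
      (∑ r : ExtRow n q, if r.Legal ∧ r.1.2 = x.1 then g r else 0) ^ 2
      = ∑ r : ExtRow n q, if r.Legal ∧ r.1.2 = x.1 then g r ^ 2 else 0 := by
    intro x
    by_cases hx : ∃ r : ExtRow n q, r.Legal ∧ r.1.2 = x.1
    · obtain ⟨r, hr, hrx⟩ := hx
      have hs : ∀ s : ExtRow n q, s ≠ r → ¬ (s.Legal ∧ s.1.2 = x.1) :=
        fun s hne h => hne (ExtRow.legal_unique h.1 (h.2.trans hrx.symm))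
      rw [Fintype.sum_eq_single r (fun s hne => if_neg (hs s hne)),
        Fintype.sum_eq_single r (fun s hne => if_neg (hs s hne)), if_pos ⟨hr, hrx⟩,
        if_pos ⟨hr, hrx⟩]
    · push Not at hx
      rw [sum_eq_zero fun r _ => if_neg fun h => hx r h.1 h.2,
        sum_eq_zero fun r _ => if_neg fun h => hx r h.1 h.2]
      simp
  simp only [h1]
  rw [sum_comm]
  refine sum_congr rfl fun r _ => ?_
  rw [Fintype.sum_eq_single ⟨r.1.2, r.elementDistinctness_eq_true⟩]
  · simp
  · rintro x hne
    refine if_neg fun h => hne (Subtype.ext h.2.symm)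

/-- Extension by zero of a vector on the negative inputs. -/
def extendNeg (v : Neg (elementDistinctness n q) → ℝ) (y : Fin n → Fin q) : ℝ :=
  if h : elementDistinctness n q y = false then v ⟨y, h⟩ else 0

lemma sum_mul_extendNeg (g : (Fin n → Fin q) → ℝ) (v : Neg (elementDistinctness n q) → ℝ) :
    ∑ y, g y * extendNeg v y = ∑ y : Neg (elementDistinctness n q), g y.1 * v y := by
  have h : ∀ y : Neg (elementDistinctness n q), v y = extendNeg v y.1 := by
    intro y
    simp [extendNeg, y.2]
  simp only [h]
  rw [← sum_subtype (univ.filter fun y => elementDistinctness n q y = false) (by simp)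
    (fun y => g y * extendNeg v y), sum_filter]
  refine sum_congr rfl fun y _ => ?_
  split_ifs with hy
  · rfl
  · simp [extendNeg, hy]

lemma sum_extendNeg_sq (v : Neg (elementDistinctness n q) → ℝ) :
    ∑ y, extendNeg v y ^ 2 = ∑ y, v y ^ 2 := by
  simp only [sq]
  rw [sum_mul_extendNeg]
  refine sum_congr rfl fun y _ => ?_
  simp [extendNeg, y.2]

-- The multiplier `m` lets one identity serve both `Γ` (with `m = 1`) and `Γ ∘ Δ_i`.
open Classical in
lemma sum_struckMatrix_sq (α : ℕ → ℝ) (m : (Fin n → Fin q) → (Fin n → Fin q) → ℝ)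
    (v : Neg (elementDistinctness n q) → ℝ) :
    ∑ x, (∑ y, struckMatrix n q α x y * m x.1 y.1 * v y) ^ 2
      = ∑ r : ExtRow n q, if r.Legal then
          (∑ y, enlargedMatrix n q α r y * m r.1.2 y * extendNeg v y) ^ 2 else 0 := by
  rw [← sum_sq_legal]
  refine sum_congr rfl fun x _ => ?_
  congr 1
  simp only [sum_mul_extendNeg (fun y => enlargedMatrix n q α _ y * m _ y)]
  simp only [struckMatrix, Matrix.of_apply, sum_mul]
  rw [sum_comm]
  refine sum_congr rfl fun r _ => ?_
  by_cases h : r.Legal ∧ r.1.2 = x.1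
  · simp [h]
  · simp [h]

lemma sum_extRow (g : Fin n → Fin n → (Fin n → Fin q) → ℝ) :
    ∑ r : ExtRow n q, g r.1.1.1 r.1.1.2 r.1.2
      = ∑ a, ∑ b, if a < b then ∑ x : Fin n → Fin q, (if x a = x b then g a b x else 0) else 0 := by
  rw [← sum_subtype (univ.filter fun r : (Fin n × Fin n) × (Fin n → Fin q) =>
    r.1.1 < r.1.2 ∧ r.2 r.1.1 = r.2 r.1.2) (by simp) (fun r => g r.1.1 r.1.2 r.2), sum_filter,
    Fintype.sum_prod_type, Fintype.sum_prod_type]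
  refine sum_congr rfl fun a _ => sum_congr rfl fun b _ => ?_
  by_cases h : a < b <;> simp [h]

/-! ### The upper bound on `‖Γ ∘ Δ_i‖` -/

lemma blockCoeff_comm (α : ℕ → ℝ) (a b : Fin n) : blockCoeff α a b = blockCoeff α b a := by
  ext S
  simp only [blockCoeff, and_comm, erase_right_comm]

lemma foldCoeff_blockCoeff_sq_le {α : ℕ → ℝ} {ε : ℝ} (hε : 0 ≤ ε)
    (hα : ∀ k, (α k - α (k + 1)) ^ 2 ≤ ε)
    {a b i : Fin n} (hia : i ≠ a) (hib : i ≠ b) (S : Finset (Fin n)) :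
    foldCoeff i (blockCoeff α a b) S ^ 2 ≤ ε := by
  unfold foldCoeff
  split_ifs with hi
  · simpa using hε
  · have hcard : #(((insert i S).erase a).erase b) = #((S.erase a).erase b) + 1 := by
      rw [erase_insert_of_ne hia, erase_insert_of_ne hib, card_insert_of_notMem]
      simp [hi]
    simp only [blockCoeff, mem_insert, hia.symm, hib.symm, false_or, hcard]
    split_ifs
    · simpa using hε
    · exact hα _

/-- For `i, b ∉ S`, the sets `S` and `S ∪ {i}` carry the same weight and cancel. For `b ∈ S`, the
set `S ∪ {i}` contains both positions of the block and has coefficient `0`, so nothing cancels. -/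
lemma foldCoeff_blockCoeff_self (α : ℕ → ℝ) {i b : Fin n} (hib : i ≠ b) (S : Finset (Fin n)) :
    foldCoeff i (blockCoeff α i b) S = if i ∉ S ∧ b ∈ S then α (#S - 1) else 0 := by
  unfold foldCoeff
  by_cases hi : i ∈ S
  · simp [hi]
  · by_cases hb : b ∈ S
    · simp [blockCoeff, hi, hb]
    · simp [blockCoeff, hi, hb, hib.symm]

lemma sum_diagonal_fold_self (α : ℕ → ℝ) {i b : Fin n} (hib : i ≠ b)
    (v : (Fin n → Fin q) → ℝ) :
    q * ∑ x : Fin n → Fin q,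
        (if x i = x b then (∑ y, scheme (foldCoeff i (blockCoeff α i b)) x y * v y) ^ 2 else 0)
      = ∑ S, if i ∉ S ∧ b ∈ S then α (#S - 1) ^ 2 * energy S v else 0 := by
  rw [sum_diagonal_scheme_sq hib (fun S h => by simp [foldCoeff, h])]
  refine sum_congr rfl fun S _ => ?_
  rw [foldCoeff_blockCoeff_self α hib]
  split_ifs <;> simp

lemma sum_fold_self_le {α : ℕ → ℝ} (hα : ∀ k : ℕ, (k + 1) * α k ^ 2 ≤ 2) (i : Fin n)
    (v : (Fin n → Fin q) → ℝ) :
    ∑ b, ∑ S, (if i ∉ S ∧ b ∈ S then α (#S - 1) ^ 2 * energy S v else 0)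
      ≤ 2 * ∑ x, v x ^ 2 := by
  rw [sum_comm, ← sum_energy, mul_sum]
  refine sum_le_sum fun S _ => ?_
  have hE := energy_nonneg S v
  by_cases hi : i ∈ S
  · simp [hi, hE]
  · simp only [hi, not_false_eq_true, true_and]
    rw [← sum_filter, sum_const, nsmul_eq_mul, ← mul_assoc]
    refine mul_le_mul_of_nonneg_right ?_ hE
    have hf : univ.filter (fun b => b ∈ S) = S := by ext; simp
    rw [hf]
    -- The truncated `#S - 1` is harmless at `S = ∅`, where the count of `b` is zero.
    rcases Nat.eq_zero_or_pos #S with h0 | h0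
    · simp [h0]
    · have := hα (#S - 1)
      rwa [← Nat.cast_add_one, Nat.sub_add_cancel h0] at this

/-- The three cases are put into one additive bound so that it can be summed over all pairs. -/
lemma sum_diagonal_fold_le {α : ℕ → ℝ} (hα : ∀ k, (α k - α (k + 1)) ^ 2 ≤ 1 / (n : ℝ) ^ 2)
    {a b : Fin n} (hab : a ≠ b) (i : Fin n) (v : (Fin n → Fin q) → ℝ) :
    q * ∑ x : Fin n → Fin q,
        (if x a = x b then (∑ y, scheme (foldCoeff i (blockCoeff α a b)) x y * v y) ^ 2 else 0)
      ≤ 2 / (n : ℝ) ^ 2 * ∑ x, v x ^ 2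
        + (if a = i then ∑ S, (if i ∉ S ∧ b ∈ S then α (#S - 1) ^ 2 * energy S v else 0) else 0)
        + (if b = i then
            ∑ S, (if i ∉ S ∧ a ∈ S then α (#S - 1) ^ 2 * energy S v else 0) else 0) := by
  have hV : 0 ≤ 2 / (n : ℝ) ^ 2 * ∑ x, v x ^ 2 := by positivity
  by_cases ha : a = i
  · subst ha
    rw [sum_diagonal_fold_self α hab, if_pos rfl, if_neg hab.symm]
    linarith
  by_cases hb : b = i
  · subst hb
    rw [if_neg ha, if_pos rfl, ← sum_diagonal_fold_self α hab.symm, blockCoeff_comm α b a]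
    simp only [eq_comm (a := (_ : Fin n → Fin q) b)]
    linarith
  · rw [if_neg ha, if_neg hb, add_zero, add_zero]
    refine (sum_diagonal_scheme_sq_le hab ?_ v).trans ?_
    · intro S h1 h2
      simp [foldCoeff, blockCoeff, h1, h2]
    · rw [← sum_energy, mul_sum, mul_sum]
      refine sum_le_sum fun S _ => ?_
      have := mul_le_mul_of_nonneg_right (foldCoeff_blockCoeff_sq_le (by positivity) hα
        (Ne.symm ha) (Ne.symm hb) S) (energy_nonneg S v)
      calc _ ≤ 2 * (1 / (n : ℝ) ^ 2 * energy S v) := by linarith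
        _ = _ := by ring

lemma sum_extRow_fold_le {α : ℕ → ℝ} (hα₁ : ∀ k, (α k - α (k + 1)) ^ 2 ≤ 1 / (n : ℝ) ^ 2)
    (hα₂ : ∀ k : ℕ, (k + 1) * α k ^ 2 ≤ 2) (i : Fin n) (v : (Fin n → Fin q) → ℝ) :
    ∑ r : ExtRow n q, (∑ y, √(q : ℝ) *
        scheme (foldCoeff i (blockCoeff α r.1.1.1 r.1.1.2)) r.1.2 y * v y) ^ 2
      ≤ 6 * ∑ y, v y ^ 2 := by
  have hn : (n : ℝ) ≠ 0 := by
    have := i.pos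
    positivity
  set V := ∑ y, v y ^ 2 with hV
  have hV0 : 0 ≤ V := by positivity
  set C : Fin n → ℝ := fun b =>
    ∑ S, (if i ∉ S ∧ b ∈ S then α (#S - 1) ^ 2 * energy S v else 0) with hC
  have hC0 : ∀ b, 0 ≤ C b := by
    intro b
    refine sum_nonneg fun S _ => ?_
    split_ifs
    · exact mul_nonneg (sq_nonneg _) (energy_nonneg S v)
    · exact le_rfl
  have hCs : ∑ b, C b ≤ 2 * V := sum_fold_self_le hα₂ i v
  rw [sum_extRow (fun a b x => (∑ y, √(q : ℝ) *
        scheme (foldCoeff i (blockCoeff α a b)) x y * v y) ^ 2)]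
  calc _ ≤ ∑ a, ∑ b, (2 / (n : ℝ) ^ 2 * V + (if a = i then C b else 0)
          + (if b = i then C a else 0)) := by
        refine sum_le_sum fun a _ => sum_le_sum fun b _ => ?_
        by_cases hab : a < b
        · rw [if_pos hab]
          refine le_trans (le_of_eq ?_) (sum_diagonal_fold_le hα₁ hab.ne i v)
          rw [mul_sum]
          refine sum_congr rfl fun x _ => ?_
          split_ifs
          · simp only [mul_assoc, ← mul_sum]
            rw [mul_pow, Real.sq_sqrt (Nat.cast_nonneg q)]
          · simp
        · rw [if_neg hab]
          have h1 : 0 ≤ 2 / (n : ℝ) ^ 2 * V := by positivity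
          have h2 := hC0 a
          have h3 := hC0 b
          split_ifs <;> linarith
    -- All `n²` ordered pairs are charged `2/n²`; the pairs with `i` first and those with `i` second
    -- are each charged at most `2 * V`.
    _ = 2 * V + ∑ b, C b + ∑ a, C a := by
        simp only [sum_add_distrib, sum_const, card_univ, Fintype.card_fin, nsmul_eq_mul,
          sum_ite_eq', mem_univ, if_true]
        congr 2
        · field_simp
        · rw [sum_comm]
          simp
    _ ≤ 6 * V := by linarith

lemma sum_struckMatrix_hadamard_le {α : ℕ → ℝ}
    (hα₁ : ∀ k, (α k - α (k + 1)) ^ 2 ≤ 1 / (n : ℝ) ^ 2)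
    (hα₂ : ∀ k : ℕ, (k + 1) * α k ^ 2 ≤ 2) (i : Fin n)
    (v : Neg (elementDistinctness n q) → ℝ) :
    ∑ x, (((struckMatrix n q α ⊙ Delta (elementDistinctness n q) i) *ᵥ v) x) ^ 2
      ≤ 24 * ∑ y, v y ^ 2 := by
  classical
  have h1 := sum_struckMatrix_sq α (fun x y => if x i ≠ y i then 1 else 0) v
  have h2 := sum_hadamard_sq_le (R := ExtRow n q) (fun r => r.1.2) i
    (fun r y => √(q : ℝ) * scheme (foldCoeff i (blockCoeff α r.1.1.1 r.1.1.2)) r.1.2 y)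
    (sum_extRow_fold_le hα₁ hα₂ i) (extendNeg v)
  rw [sum_extendNeg_sq] at h2
  calc _ = _ := h1
    _ ≤ _ := sum_le_sum fun r _ => ?_
    _ ≤ _ := h2
    _ = _ := by norm_num
  -- Restoring illegal rows only adds squares, and folding leaves the entries with `x i ≠ y i`
  -- unchanged.
  refine le_trans (b := (∑ y, enlargedMatrix n q α r y * (if r.1.2 i ≠ y i then 1 else 0)
    * extendNeg v y) ^ 2) (by split_ifs; exacts [le_rfl, sq_nonneg _]) (le_of_eq ?_)
  congr 1
  refine sum_congr rfl fun y _ => ?_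
  by_cases h : r.1.2 i = y i
  · simp [h]
  · simp only [ne_eq, h, not_false_eq_true, if_true, mul_one]
    rw [scheme_foldCoeff _ h, ← G_eq_scheme α r.2.1.ne r.2.2]
    rfl

/-! ### The lower bound on `‖Γ‖` -/

/-- The average of `v` over the coordinate `a`. -/
def coordAvg (a : Fin n) (v : (Fin n → Fin q) → ℝ) (x : Fin n → Fin q) : ℝ :=
  (∑ s, v (Function.update x a s)) / q

lemma coordAvg_update (a : Fin n) (v : (Fin n → Fin q) → ℝ) (x : Fin n → Fin q) (s : Fin q) :
    coordAvg a v (Function.update x a s) = coordAvg a v x := by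
  simp [coordAvg]

lemma sum_coordAvg (hq : q ≠ 0) (a : Fin n) (v : (Fin n → Fin q) → ℝ) :
    ∑ x, coordAvg a v x = ∑ x, v x := by
  have : (q : ℝ) ≠ 0 := by exact_mod_cast hq
  simp only [coordAvg, ← sum_div, sum_sum_update]
  field_simp

/-- For `a ∉ S` the factor of `tensorProj S` at `a` is `E₀`, which already averages over that
coordinate. -/
lemma tensorProj_coordAvg (hq : q ≠ 0) {a : Fin n} {S : Finset (Fin n)} (ha : a ∉ S)
    (v : (Fin n → Fin q) → ℝ) (x : Fin n → Fin q) :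
    ∑ y, tensorProj S x y * coordAvg a v y = ∑ y, tensorProj S x y * v y := by
  rw [← sum_coordAvg hq a (fun y => tensorProj S x y * v y)]
  refine sum_congr rfl fun y _ => ?_
  simp only [coordAvg, tensorProj_symm S x, tensorProj_update ha]
  rw [← mul_sum, mul_div_assoc]

lemma sum_coordAvg_sq_le (hq : q ≠ 0) (a : Fin n) (v : (Fin n → Fin q) → ℝ) :
    ∑ x, coordAvg a v x ^ 2 ≤ ∑ x, v x ^ 2 := by
  rw [← sum_coordAvg hq a (fun x => v x ^ 2)]
  refine sum_le_sum fun x _ => ?_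
  have h := sq_sum_le_card_mul_sum_sq (s := (univ : Finset (Fin q)))
    (f := fun s => v (Function.update x a s))
  rw [card_univ, Fintype.card_fin] at h
  have hq' : (0 : ℝ) < q := by positivity
  rw [coordAvg, coordAvg, div_pow, div_le_div_iff₀ (by positivity) hq']
  nlinarith

lemma sum_diagonal_coordAvg (hq : q ≠ 0) {a b : Fin n} (hab : a ≠ b) {S : Finset (Fin n)}
    (ha : a ∉ S) (v : (Fin n → Fin q) → ℝ) :
    q * ∑ x : Fin n → Fin q, (if x a = x b then
        coordAvg a v x * ∑ y, tensorProj S x y * v y else 0) = energy S (coordAvg a v) := by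
  simp only [← tensorProj_coordAvg hq ha v]
  rw [sum_diagonal hab (fun x => coordAvg a v x * ∑ y, tensorProj S x y * coordAvg a v y)]
  · rfl
  · intro x s
    simp only [coordAvg_update, tensorProj_update ha]

/-- The indicator of the strings with pairwise distinct symbols. -/
def legalIndicator (n q : ℕ) : (Fin n → Fin q) → ℝ := extendNeg fun _ => 1

lemma legalIndicator_apply (x : Fin n → Fin q) [Decidable (Function.Injective x)] :
    legalIndicator n q x = if Function.Injective x then 1 else 0 := by
  simp only [legalIndicator, extendNeg, elementDistinctness_eq_false]
  split_ifs <;> rfl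

/-- Overwriting `a` or `b` by `s` gives strings that differ by a transposition of positions, which
preserves injectivity. -/
lemma coordAvg_legalIndicator_comm {a b : Fin n} {x : Fin n → Fin q} (hx : x a = x b) :
    coordAvg a (legalIndicator n q) x = coordAvg b (legalIndicator n q) x := by
  classical
  unfold coordAvg
  congr 1
  refine sum_congr rfl fun s _ => ?_
  have : Function.update x a s = Function.update x b s ∘ Equiv.swap a b := by
    ext j
    rcases eq_or_ne j a with rfl | hja
    · simp
    rcases eq_or_ne j b with rfl | hjb
    · simp only [Function.comp_apply, Equiv.swap_apply_right, Function.update_of_ne hja, ← hx]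
      rw [Function.update_of_ne hja.symm, hx]
    · simp [Equiv.swap_apply_of_ne_of_ne hja hjb, Function.update_of_ne, hja, hjb]
  rw [legalIndicator_apply, legalIndicator_apply, this]
  simp only [EquivLike.injective_comp]

/-- A collision survives overwriting `a`: either the extra colliding pair avoids `a`, or its other
member collides with `b`. -/
lemma coordAvg_legalIndicator_of_not_legal {r : ExtRow n q} (hr : ¬ r.Legal) :
    coordAvg r.1.1.1 (legalIndicator n q) r.1.2 = 0 := by
  classical
  obtain ⟨⟨⟨a, b⟩, x⟩, hab, hx⟩ := r
  dsimp only at hab hx ⊢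
  unfold coordAvg
  rw [sum_eq_zero, zero_div]
  intro s _
  rw [legalIndicator_apply, if_neg]
  intro hinj
  refine hr fun i j hij hxij => ?_
  have key : ∀ i j, i ≠ a → j ≠ a → x i = x j → i = j := by
    intro i j hi hj h
    apply hinj
    rw [Function.update_of_ne hi, Function.update_of_ne hj, h]
  dsimp only at hxij ⊢
  by_cases hi : i = a
  · subst hi
    rw [key j b hij.ne' hab.ne' (hxij.symm.trans hx)]
  · by_cases hj : j = a
    · subst hj
      have := key i b hi hab.ne' (hxij.trans hx)
      subst this
      exact absurd hij hab.not_gt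
    · exact absurd (key i j hi hj hxij) hij.ne

/-- Every `S` with nonzero coefficient avoids `a` or `b`. The averages over `a` and `b` agree on the
diagonal, so for each `S` an avoided one can be used, making its term a nonnegative multiple of an
energy. Only `S = ∅` is kept. -/
lemma le_sum_diagonal_block (hq : q ≠ 0) {α : ℕ → ℝ} (hα : ∀ k, 0 ≤ α k) {a b : Fin n}
    (hab : a ≠ b) :
    α 0 * ((∑ x, legalIndicator n q x) ^ 2 / (q : ℝ) ^ n)
      ≤ q * ∑ x : Fin n → Fin q, (if x a = x b then coordAvg a (legalIndicator n q) x *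
          ∑ y, scheme (blockCoeff α a b) x y * legalIndicator n q y else 0) := by
  set w := legalIndicator n q with hw
  have hterm : ∀ S, (q : ℝ) * ∑ x : Fin n → Fin q, (if x a = x b then coordAvg a w x *
      (blockCoeff α a b S * ∑ y, tensorProj S x y * w y) else 0)
      = blockCoeff α a b S * energy S (coordAvg (if a ∈ S then b else a) w) := by
    intro S
    have hpull : ∀ c, (q : ℝ) * ∑ x : Fin n → Fin q, (if x a = x b then coordAvg c w x *
        (blockCoeff α a b S * ∑ y, tensorProj S x y * w y) else 0)
        = blockCoeff α a b S * (q * ∑ x : Fin n → Fin q, (if x a = x b then coordAvg c w x *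
          ∑ y, tensorProj S x y * w y else 0)) := by
      intro c
      rw [mul_left_comm, mul_sum _ _ (blockCoeff α a b S)]
      congr 1
      refine sum_congr rfl fun x _ => ?_
      split_ifs
      · ring
      · simp
    by_cases ha : a ∈ S
    · by_cases hb : b ∈ S
      · simp [blockCoeff, ha, hb]
      · rw [if_pos ha, ← sum_diagonal_coordAvg hq hab.symm hb, hpull]
        congr 2
        refine sum_congr rfl fun x _ => ?_
        by_cases hx : x a = x b
        · rw [if_pos hx, if_pos hx.symm, coordAvg_legalIndicator_comm hx]
        · rw [if_neg hx, if_neg (Ne.symm hx)]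
    · rw [if_neg ha, ← sum_diagonal_coordAvg hq hab ha, hpull]
  have hexp : (q : ℝ) * ∑ x : Fin n → Fin q, (if x a = x b then coordAvg a w x *
          ∑ y, scheme (blockCoeff α a b) x y * w y else 0)
      = ∑ S, blockCoeff α a b S * energy S (coordAvg (if a ∈ S then b else a) w) := by
    simp only [← hterm, ← mul_sum]
    rw [sum_comm]
    congr 1
    refine sum_congr rfl fun x _ => ?_
    split_ifs
    · rw [scheme_apply, mul_sum]
    · simp
  rw [hexp]
  refine le_trans (le_of_eq ?_) (single_le_sum (f := fun S => blockCoeff α a b S *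
    energy S (coordAvg (if a ∈ S then b else a) w)) (fun S _ => ?_) (mem_univ ∅))
  · simp only [energy_empty, sum_coordAvg hq]
    simp [blockCoeff]
  · refine mul_nonneg ?_ (energy_nonneg _ _)
    unfold blockCoeff
    split_ifs
    exacts [le_rfl, hα _]

lemma sum_pairs (n : ℕ) (c : ℝ) :
    ∑ a : Fin n, ∑ b : Fin n, (if a < b then c else 0) = n * (n - 1) / 2 * c := by
  have h : ∀ a b : Fin n, (if a < b then c else 0) + (if b < a then c else 0)
      = c - if a = b then c else 0 := by
    intro a b
    rcases lt_trichotomy a b with h | h | h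
    · simp [h, h.not_gt, h.ne]
    · simp [h]
    · simp [h, h.not_gt, h.ne']
  have hs : ∑ a : Fin n, ∑ b : Fin n, ((if a < b then c else 0) + (if b < a then c else 0))
      = n * (n - 1) * c := by
    simp only [h, sum_sub_distrib]
    simp
    ring
  simp only [sum_add_distrib] at hs
  rw [sum_comm (f := fun a b : Fin n => if b < a then c else 0)] at hs
  linarith

/-- Lower bound on the norm of the image of the constant vector, in terms of the number `N` of
strings with pairwise distinct symbols. -/
lemma le_sum_struckMatrix_sq (hq : q ≠ 0) {α : ℕ → ℝ} (hα : ∀ k, 0 ≤ α k) {N : ℝ}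
    (hN : N = ∑ x, legalIndicator n q x) (hN0 : 0 < N) (hn : 2 ≤ n) :
    n * (n - 1) / 2 * (α 0 * (N / (q : ℝ) ^ n)) ^ 2 * N
      ≤ ∑ x, ((struckMatrix n q α *ᵥ fun _ => 1) x) ^ 2 := by
  classical
  set w := legalIndicator n q with hw
  have hq0 : (0 : ℝ) < q := by positivity
  have hsq : √(q : ℝ) ^ 2 = q := Real.sq_sqrt hq0.le
  have hNsq : ∑ x, w x ^ 2 = N := by
    rw [hN]
    refine sum_congr rfl fun x _ => ?_
    rw [hw, legalIndicator_apply]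
    split_ifs <;> simp
  set u : ExtRow n q → ℝ := fun r => coordAvg r.1.1.1 w r.1.2 with hu
  set g : ExtRow n q → ℝ := fun r => ∑ y, enlargedMatrix n q α r y * w y with hg
  have hΓ : ∑ x, ((struckMatrix n q α *ᵥ fun _ => 1) x) ^ 2
      = ∑ r : ExtRow n q, (if r.Legal then g r else 0) ^ 2 := by
    have := sum_struckMatrix_sq α (fun _ _ => (1 : ℝ)) (fun _ : Neg (elementDistinctness n q) => 1)
    simp only [mul_one] at this
    simp only [Matrix.mulVec, dotProduct, mul_one, this]
    refine sum_congr rfl fun r _ => ?_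
    split_ifs
    · rfl
    · simp
  -- The test vector `u` vanishes on illegal rows, so the pairing can be computed in the enlarged
  -- matrix.
  have hug : ∑ r, u r * (if r.Legal then g r else 0) = ∑ r, u r * g r := by
    refine sum_congr rfl fun r _ => ?_
    split_ifs with h
    · rfl
    · simp [hu, hw, coordAvg_legalIndicator_of_not_legal h]
  have hcs := sum_mul_sq_le_sq_mul_sq univ u (fun r => if r.Legal then g r else 0)
  rw [hug, ← hΓ] at hcs
  have hP : (0 : ℝ) < n * (n - 1) / 2 := by
    have : (2 : ℝ) ≤ n := by exact_mod_cast hn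
    have : (0 : ℝ) < n - 1 := by linarith
    positivity
  -- Averaging contracts the norm, and each diagonal `x a = x b` carries a fraction `1/q` of it.
  have hu2 : ∑ r, u r ^ 2 ≤ n * (n - 1) / 2 * (N / q) := by
    rw [← sum_pairs, sum_extRow (fun a _ x => coordAvg a w x ^ 2)]
    refine sum_le_sum fun a _ => sum_le_sum fun b _ => ?_
    split_ifs with hab
    · rw [le_div_iff₀ hq0, mul_comm, sum_diagonal hab.ne (fun x => coordAvg a w x ^ 2), ← hNsq]
      · exact sum_coordAvg_sq_le hq a w
      · intro x s
        rw [coordAvg_update]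
    · exact le_rfl
  have hlow : n * (n - 1) / 2 * (α 0 * (N ^ 2 / (q : ℝ) ^ n) / √q) ≤ ∑ r, u r * g r := by
    have hgr : ∀ r : ExtRow n q, u r * g r = coordAvg r.1.1.1 w r.1.2 * (√(q : ℝ) *
        ∑ y, scheme (blockCoeff α r.1.1.1 r.1.1.2) r.1.2 y * w y) := by
      intro r
      simp only [hu, hg, mul_sum]
      refine sum_congr rfl fun y _ => ?_
      rw [← mul_assoc (√(q : ℝ)), ← G_eq_scheme α r.2.1.ne r.2.2]
      rfl
    simp only [hgr]
    rw [← sum_pairs, sum_extRow (fun a b x => coordAvg a w x * (√(q : ℝ) *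
        ∑ y, scheme (blockCoeff α a b) x y * w y))]
    refine sum_le_sum fun a _ => sum_le_sum fun b _ => ?_
    split_ifs with hab
    · rw [div_le_iff₀ (by positivity), hN]
      refine (le_sum_diagonal_block hq hα hab.ne).trans (le_of_eq ?_)
      rw [sum_mul, mul_sum]
      refine sum_congr rfl fun x _ => ?_
      split_ifs
      · rw [← hsq, Real.sqrt_sq (Real.sqrt_nonneg _)]
        ring
      · simp
    · exact le_rfl
  have hlow0 : 0 ≤ n * (n - 1) / 2 * (α 0 * (N ^ 2 / (q : ℝ) ^ n) / √q) := by
    have := hα 0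
    positivity
  have hmain := (pow_le_pow_left₀ hlow0 hlow 2).trans (hcs.trans
    (mul_le_mul_of_nonneg_right hu2 (by positivity)))
  have hPN : (0 : ℝ) < n * (n - 1) / 2 * (N / q) := by positivity
  -- The squared Cauchy–Schwarz inequality is divided by the bound on `‖u‖²`.
  refine le_of_mul_le_mul_left (le_trans (le_of_eq ?_) hmain) hPN
  rw [mul_pow (n * (n - 1) / 2 : ℝ), div_pow _ (√(q : ℝ)), hsq]
  field_simp

/-! ### The density of strings with pairwise distinct symbols -/

lemma sum_legalIndicator (n q : ℕ) : ∑ x, legalIndicator n q x = q.descFactorial n := by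
  classical
  simp only [legalIndicator_apply]
  rw [sum_boole, ← Fintype.card_subtype,
    Fintype.card_congr (Equiv.subtypeInjectiveEquivEmbedding (Fin n) (Fin q)),
    Fintype.card_embedding_eq, Fintype.card_fin, Fintype.card_fin]

/-- Factor by factor, `q / (q - i) = 1 + i / (q - i) ≤ 1 + ε ≤ exp ε`. -/
lemma exp_neg_pow_mul_le_descFactorial {ε : ℝ} (hnq : n ≤ q)
    (hε : ∀ i < n, (i : ℝ) ≤ ε * (q - i)) :
    Real.exp (-ε) ^ n * (q : ℝ) ^ n ≤ q.descFactorial n := by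
  rw [Nat.descFactorial_eq_prod_range, ← mul_pow, Nat.cast_prod]
  calc (Real.exp (-ε) * (q : ℝ)) ^ n = ∏ _i ∈ range n, (Real.exp (-ε) * (q : ℝ)) := by simp
    _ ≤ _ := prod_le_prod (fun _ _ => by positivity) fun i hi => ?_
  have hi' := mem_range.1 hi
  have h := hε i hi'
  have hiq : (i : ℝ) < q := by exact_mod_cast hi'.trans_le hnq
  rw [Nat.cast_sub (hi'.le.trans hnq), Real.exp_neg, inv_mul_le_iff₀ (Real.exp_pos _)]
  have h1 := mul_le_mul_of_nonneg_right (Real.add_one_le_exp ε) (sub_nonneg.2 hiq.le)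
  linarith

lemma exp_mul_le_descFactorial {c : ℝ} (hc : 0 < c) (hn : 0 < n) (hnq : n ≤ q)
    (hcq : c * (n : ℝ) ^ 2 ≤ q) :
    Real.exp (-(2 / c + 2 / c ^ 2)) * (q : ℝ) ^ n ≤ q.descFactorial n := by
  have hn0 : (0 : ℝ) < n := by exact_mod_cast hn
  have hnq' : (n : ℝ) ≤ q := by exact_mod_cast hnq
  have key : ∃ ε : ℝ, n * ε ≤ 2 / c + 2 / c ^ 2 ∧ ∀ i < n, (i : ℝ) ≤ ε * (q - i) := by
    -- If `q ≥ 2n`, then `q - i ≥ q/2 ≥ c n²/2`, so `ε = 2/(cn)` works. Otherwise `c n² ≤ q < 2n`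
    -- forces `n ≤ 2/c`, and `ε = 1/c` works. The two summands of the exponent cover these cases.
    rcases le_or_gt (2 * (n : ℝ)) q with h | h
    · refine ⟨2 / (c * n), ?_, fun i hi => ?_⟩
      · have : (n : ℝ) * (2 / (c * n)) = 2 / c := by field_simp
        rw [this]
        have : 0 ≤ 2 / c ^ 2 := by positivity
        linarith
      · have hi' : (i : ℝ) ≤ n := by exact_mod_cast hi.le
        rw [div_mul_eq_mul_div, le_div_iff₀ (by positivity)]
        nlinarith [mul_le_mul_of_nonneg_left hi' (by positivity : 0 ≤ c * (n : ℝ))]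
    · refine ⟨1 / c, ?_, fun i hi => ?_⟩
      · have h2 : n ≤ 2 / c := by
          rw [le_div_iff₀ hc]
          nlinarith
        have : 0 ≤ 2 / c := by positivity
        calc (n : ℝ) * (1 / c) ≤ 2 / c * (1 / c) := by gcongr
          _ = 2 / c ^ 2 := by field_simp
          _ ≤ _ := by linarith
      · have hi' : (i : ℝ) + 1 ≤ n := by exact_mod_cast hi
        have hi0 : (0 : ℝ) ≤ i := Nat.cast_nonneg i
        rw [div_mul_eq_mul_div, le_div_iff₀ hc, one_mul]
        -- Since `i ≤ n - 1`, the difference is at least `(n - 1) * (q - n)`.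
        have h3 : (q : ℝ) ≤ n * (q - i) := by nlinarith
        refine le_of_mul_le_mul_left ?_ hn0
        nlinarith [mul_le_mul_of_nonneg_right (by linarith : (i : ℝ) ≤ n)
          (by positivity : 0 ≤ c * (n : ℝ))]
  obtain ⟨ε, hε, hi⟩ := key
  refine le_trans ?_ (exp_neg_pow_mul_le_descFactorial hnq hi)
  gcongr
  rw [← Real.exp_nat_mul]
  gcongr
  linarith

/-! ### The weights -/

/-- The weights `α_k = max (n^{-1/3} - k/n) 0`. -/
def weight (n k : ℕ) : ℝ := max ((n : ℝ) ^ (-(1 / 3) : ℝ) - k / n) 0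

lemma weight_nonneg (n k : ℕ) : 0 ≤ weight n k := le_max_right _ _

lemma weight_zero (n : ℕ) : weight n 0 = (n : ℝ) ^ (-(1 / 3) : ℝ) := by
  simp only [weight, Nat.cast_zero, zero_div, sub_zero]
  exact max_eq_left (by positivity)

lemma weight_sub_sq_le (n k : ℕ) : (weight n k - weight n (k + 1)) ^ 2 ≤ 1 / (n : ℝ) ^ 2 := by
  rw [← one_div_pow, ← sq_abs]
  refine pow_le_pow_left₀ (abs_nonneg _) ((abs_max_sub_max_le_abs _ _ _).trans (le_of_eq ?_)) 2
  rw [abs_of_nonneg]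
  · push_cast
    ring
  · push_cast
    rw [sub_sub_sub_cancel_left, ← sub_div]
    have : (k : ℝ) + 1 - k = 1 := by ring
    rw [this]
    positivity

/-- With `z = n^{-1/3}`, a nonzero weight needs `k < n * z`, and `n * z ^ 3 = 1` is the balance that
fixes the exponent `1/3`. The extra `1` in `k + 1` costs only `z ^ 2 ≤ 1`. -/
lemma succ_mul_weight_sq_le (hn : 0 < n) (k : ℕ) : (k + 1) * weight n k ^ 2 ≤ 2 := by
  have hn1 : (1 : ℝ) ≤ n := by exact_mod_cast hn
  have hn0 : (0 : ℝ) < n := by linarith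
  set z : ℝ := (n : ℝ) ^ (-(1 / 3) : ℝ) with hz
  have hz0 : 0 < z := by positivity
  have hz1 : z ≤ 1 := Real.rpow_le_one_of_one_le_of_nonpos hn1 (by norm_num)
  have hz3 : n * z ^ 3 = 1 := by
    rw [hz, ← Real.rpow_natCast, ← Real.rpow_mul hn0.le]
    norm_num
    rw [Real.rpow_neg_one, mul_inv_cancel₀ hn0.ne']
  rcases le_or_gt z (k / n) with h | h
  · rw [weight, max_eq_right (sub_nonpos.2 h)]
    norm_num
  · have hk : (k : ℝ) ≤ n * z := by
      rw [div_lt_iff₀ hn0] at h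
      linarith
    have hw : weight n k ≤ z := max_le (sub_le_self _ (by positivity)) hz0.le
    calc (k + 1) * weight n k ^ 2 ≤ (n * z + 1) * z ^ 2 := by
          have := weight_nonneg n k
          gcongr
      _ = n * z ^ 3 + z ^ 2 := by ring
      _ ≤ 1 + 1 := by
          rw [hz3]
          have : z ^ 2 ≤ 1 := pow_le_one₀ hz0.le hz1
          linarith
      _ = 2 := by norm_num

/-! ### Spectral norms -/

section SpecNorm

open scoped Matrix.Norms.L2Operator

variable {m k : Type*} [Fintype m] [Fintype k] [DecidableEq k]

lemma specNorm_nonneg (A : Matrix m k ℝ) : 0 ≤ specNorm A := norm_nonneg A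

lemma specNorm_pos {A : Matrix m k ℝ} (hA : A ≠ 0) : 0 < specNorm A := norm_pos_iff.2 hA

lemma specNorm_le {A : Matrix m k ℝ} {B : ℝ} (hB : 0 ≤ B)
    (h : ∀ v : k → ℝ, ∑ x, (A *ᵥ v) x ^ 2 ≤ B ^ 2 * ∑ y, v y ^ 2) : specNorm A ≤ B := by
  rw [specNorm, Matrix.l2_opNorm_def]
  refine ContinuousLinearMap.opNorm_le_bound _ hB fun v => ?_
  refine le_of_sq_le_sq ?_ (by positivity)
  rw [mul_pow, EuclideanSpace.real_norm_sq_eq, EuclideanSpace.real_norm_sq_eq]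
  exact h v

lemma sum_mulVec_sq_le (A : Matrix m k ℝ) (v : k → ℝ) :
    ∑ x, (A *ᵥ v) x ^ 2 ≤ specNorm A ^ 2 * ∑ y, v y ^ 2 := by
  have h := pow_le_pow_left₀ (norm_nonneg _) (Matrix.l2_opNorm_mulVec A (WithLp.toLp 2 v)) 2
  rw [mul_pow, EuclideanSpace.real_norm_sq_eq, EuclideanSpace.real_norm_sq_eq] at h
  exact h

end SpecNorm

/-! ### Numerator and denominator for the chosen weights -/

lemma maxDeltaNorm_pos {f : (Fin n → Fin q) → Bool} {Γ : AdvMatrix f} (hΓ : Γ ≠ 0) :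
    0 < maxDeltaNorm f Γ := by
  obtain ⟨x, y, hxy⟩ : ∃ x y, Γ x y ≠ 0 := by
    by_contra! h
    exact hΓ (Matrix.ext h)
  obtain ⟨i, hi⟩ : ∃ i, x.1 i ≠ y.1 i := by
    by_contra! h
    have := x.2
    rw [funext h, y.2] at this
    exact Bool.false_ne_true this
  refine lt_of_lt_of_le (specNorm_pos (A := Γ ⊙ Delta f i) fun h => hxy ?_)
    (le_ciSup (f := fun i => specNorm (Γ ⊙ Delta f i)) (Set.finite_range _).bddAbove i)
  have := congrFun (congrFun h x) y
  simpa [Delta, hi] using this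

lemma maxDeltaNorm_struckMatrix_le (hn : 0 < n) :
    maxDeltaNorm (elementDistinctness n q) (struckMatrix n q (weight n)) ≤ 5 := by
  have : Nonempty (Fin n) := ⟨⟨0, hn⟩⟩
  refine ciSup_le fun i => specNorm_le (by norm_num) fun v => ?_
  refine (sum_struckMatrix_hadamard_le (weight_sub_sq_le n) (succ_mul_weight_sq_le hn) i v).trans ?_
  gcongr
  -- This is `24 ≤ 5 ^ 2`.
  norm_num

lemma le_specNorm_struckMatrix {p : ℝ} (hn : 2 ≤ n) (hnq : n ≤ q) (hp : 0 ≤ p)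
    (hpN : p * (q : ℝ) ^ n ≤ q.descFactorial n) :
    p / 2 * (n : ℝ) ^ (2 / 3 : ℝ) ≤ specNorm (struckMatrix n q (weight n)) := by
  have hq : q ≠ 0 := by omega
  have hq0 : (0 : ℝ) < q := by positivity
  have hn2 : (2 : ℝ) ≤ n := by exact_mod_cast hn
  have hn0 : (0 : ℝ) < n := by linarith
  set N : ℝ := ((q.descFactorial n : ℕ) : ℝ) with hN
  have hN0 : 0 < N := by
    rw [hN]
    exact_mod_cast Nat.pos_of_ne_zero fun h => absurd (Nat.descFactorial_eq_zero_iff_lt.1 h)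
      (by omega)
  have h1 := le_sum_struckMatrix_sq hq (weight_nonneg n) (sum_legalIndicator n q).symm hN0 hn
  have h2 := h1.trans (sum_mulVec_sq_le _ _)
  have h3 : ∑ y : Neg (elementDistinctness n q), (1 : ℝ) ^ 2 = N := by
    have := sum_extendNeg_sq (n := n) (q := q) fun _ => 1
    rw [← this, hN, ← sum_legalIndicator]
    refine sum_congr rfl fun x _ => ?_
    classical
    change legalIndicator n q x ^ 2 = _
    rw [legalIndicator_apply]
    split_ifs <;> simp
  rw [h3] at h2
  have h4 := le_of_mul_le_mul_right h2 hN0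
  refine le_of_sq_le_sq ?_ (specNorm_nonneg _)
  refine le_trans ?_ h4
  have hpow : (n : ℝ) ^ (2 / 3 : ℝ) = n * weight n 0 := by
    rw [weight_zero, ← Real.rpow_one_add' hn0.le (by norm_num)]
    norm_num
  have hpd : p ≤ N / (q : ℝ) ^ n := by
    rwa [le_div_iff₀ (by positivity)]
  have hw := weight_nonneg n 0
  calc (p / 2 * (n : ℝ) ^ (2 / 3 : ℝ)) ^ 2 = (n : ℝ) ^ 2 / 4 * (weight n 0 * p) ^ 2 := by
        rw [hpow]
        ring
    _ ≤ n * (n - 1) / 2 * (weight n 0 * (N / (q : ℝ) ^ n)) ^ 2 := by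
        -- This is where `n ≥ 2` yields the factor `1/2` in the bound.
        have hquad : (n : ℝ) ^ 2 / 4 ≤ n * (n - 1) / 2 := by nlinarith
        exact mul_le_mul hquad (by gcongr) (by positivity) (le_trans (by positivity) hquad)

end AdvED

end

theorem mainTheorem1 :
    ∀ c : ℝ, 0 < c → ∃ C : ℝ, 0 < C ∧
      ∀ n q : ℕ, 2 ≤ n → n ≤ q → c * (n : ℝ) ^ 2 ≤ (q : ℝ) →
        (∃ Γ : AdvED.AdvMatrix (AdvED.elementDistinctness n q),
          Γ ≠ 0 ∧
          (∃ α : ℕ → ℝ, (∀ k, 0 ≤ α k) ∧ Γ = AdvED.struckMatrix n q α) ∧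
          0 < AdvED.maxDeltaNorm (AdvED.elementDistinctness n q) Γ ∧
          C * (n : ℝ) ^ (2 / 3 : ℝ) ≤ AdvED.advRatio (AdvED.elementDistinctness n q) Γ) ∧
        ENNReal.ofReal (C * (n : ℝ) ^ (2 / 3 : ℝ)) ≤ AdvED.adv (AdvED.elementDistinctness n q) := by
  intro c hc
  set p := Real.exp (-(2 / c + 2 / c ^ 2)) with hp
  have hp0 : 0 < p := Real.exp_pos _
  -- The numerator contributes `p / 2` and the denominator is at most `5`.
  refine ⟨p / 10, by positivity, fun n q hn hnq hcq => ?_⟩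
  have hn0 : (0 : ℝ) < n := by
    have : 0 < n := by omega
    exact_mod_cast this
  set Γ := AdvED.struckMatrix n q (AdvED.weight n) with hΓ
  have hlow : p / 2 * (n : ℝ) ^ (2 / 3 : ℝ) ≤ AdvED.specNorm Γ :=
    AdvED.le_specNorm_struckMatrix hn hnq hp0.le
      (AdvED.exp_mul_le_descFactorial hc (by omega) hnq hcq)
  have hne : Γ ≠ 0 := by
    intro h
    have h0 : AdvED.specNorm Γ ≤ 0 := AdvED.specNorm_le le_rfl fun v => by simp [h]
    have : 0 < p / 2 * (n : ℝ) ^ (2 / 3 : ℝ) := by positivity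
    linarith
  have hpos := AdvED.maxDeltaNorm_pos hne
  have hup : AdvED.maxDeltaNorm (AdvED.elementDistinctness n q) Γ ≤ 5 :=
    AdvED.maxDeltaNorm_struckMatrix_le (by omega)
  have hratio : p / 10 * (n : ℝ) ^ (2 / 3 : ℝ)
      ≤ AdvED.advRatio (AdvED.elementDistinctness n q) Γ := by
    rw [AdvED.advRatio, le_div_iff₀ hpos]
    calc _ ≤ p / 10 * (n : ℝ) ^ (2 / 3 : ℝ) * 5 := by gcongr
      _ = p / 2 * (n : ℝ) ^ (2 / 3 : ℝ) := by ring
      _ ≤ _ := hlow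
  refine ⟨⟨Γ, hne, ⟨AdvED.weight n, AdvED.weight_nonneg n, rfl⟩, hpos, hratio⟩, ?_⟩
  exact (ENNReal.ofReal_le_ofReal hratio).trans
    (le_iSup₂ (f := fun (Γ : AdvED.AdvMatrix (AdvED.elementDistinctness n q)) (_ : Γ ≠ 0) =>
      ENNReal.ofReal (AdvED.advRatio (AdvED.elementDistinctness n q) Γ)) Γ hne)
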